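/- Let $\beta\ge 0$. For $c>0$ let $\Omega(c,c)=(-c,c)\times(-c,c)$ be the square of side $2c$, and let $\lambda_1(c,c)$ be its fundamental Robin eigenvalue, i.e. the smallest real $\lambda$ for which there is a function $u$, not identically zero, $C^2$ in $\Omega(c,c)$ and $C^1$ up to the boundary, with $$\Delta u+\lambda u=0\ \text{ in }\Omega(c,c),\qquad \beta\frac{\partial u}{\partial n}+u=0\ \text{ on the (relatively open) sides of }\Omega(c,c),$$ where $n$ is the outward unit normal (for $\beta=0$ this is the Dirichlet condition). Let $\mu(c)$ be the smallest positive solution of $\mu\tan(c\mu)=1/\beta$ if $\beta>0$, and $\mu(c)=\pi/(2c)$ if $\beta=0$; put $\mu_{(2)}(c)=\mu(c)^2$. Then: 1. For every $c>0$ the smallest eigenvalue $\lambda_1(c,c)$ exists, and $\lambda_1(c,c)=2\mu_{(2)}(c)$. 2. For all $h>0$ and $0<r\le 1$, the eigenvalue of the square of side $2h$ is at least the geometric mean of the eigenvalues of the squares of sides $2rh$ and $2h/r$: $$\sqrt{\lambda_1(rh,rh)\,\lambda_1(h/r,h/r)}\ \le\ \lambda_1(h,h).$$ 3. Equivalently,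 $\mu_{(2)}:(0,\infty)\to(0,\infty)$ is GG-concave: $\mu_{(2)}(c)>0$ for all $c>0$, and $\sqrt{\mu_{(2)}(x_0)\,\mu_{(2)}(x_1)}\le \mu_{(2)}\!\left(\sqrt{x_0x_1}\right)$ for all $x_0,x_1>0$. -/

import Mathlib

open Real Set

noncomputable section

/-- The open box `(-a₁, a₁) × ⋯ × (-a_N, a_N)`. -/
def box {N : ℕ} (a : Fin N → ℝ) : Set (EuclideanSpace ℝ (Fin N)) :=
  {x | ∀ j, x j ∈ Ioo (-a j) (a j)}

/-- The closed box `[-a₁, a₁] × ⋯ × [-a_N, a_N]`. -/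
def closedBox {N : ℕ} (a : Fin N → ℝ) : Set (EuclideanSpace ℝ (Fin N)) :=
  {x | ∀ j, x j ∈ Icc (-a j) (a j)}

/-- The relatively open face of the box with outward unit normal `σ e_j` (`σ = 1` or `σ = -1`).
Edges and corners, which have no normal, belong to no face. -/
def boxFace {N : ℕ} (a : Fin N → ℝ) (j : Fin N) (σ : ℝ) : Set (EuclideanSpace ℝ (Fin N)) :=
  {x | x j = σ * a j ∧ ∀ i, i ≠ j → x i ∈ Ioo (-a i) (a i)}

/-- `u` is a Robin eigenfunction of the box with eigenvalue `lam`: a function that is `C²` in the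
open box and `C¹` up to the boundary, not identically zero, with `Δu + lam u = 0` in the box and
`β ∂u/∂n + u = 0` on every face (`n` the outward unit normal). -/
structure IsRobinEigenfunction {N : ℕ} (β : ℝ) (a : Fin N → ℝ) (lam : ℝ)
    (u : EuclideanSpace ℝ (Fin N) → ℝ) : Prop where
  contDiffOn_box : ContDiffOn ℝ 2 u (box a)
  contDiffOn_closedBox : ContDiffOn ℝ 1 u (closedBox a)
  ne_zero : ∃ x ∈ box a, u x ≠ 0
  helmholtz : ∀ x ∈ box a, Laplacian.laplacian u x + lam * u x = 0
  robin : ∀ (j : Fin N) (σ : ℝ), (σ = 1 ∨ σ = -1) → ∀ x ∈ boxFace a j σ,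
    β * fderivWithin ℝ u (closedBox a) x (EuclideanSpace.single j σ) + u x = 0

/-- The set of Robin eigenvalues of the box. -/
def robinEigenvalues {N : ℕ} (β : ℝ) (a : Fin N → ℝ) : Set ℝ :=
  {lam | ∃ u, IsRobinEigenfunction β a lam u}

/-- The fundamental (smallest) Robin eigenvalue of the box. -/
def robinLambda₁ {N : ℕ} (β : ℝ) (a : Fin N → ℝ) : ℝ :=
  sInf (robinEigenvalues β a)

/-- For `β > 0`, the smallest positive solution `m` of `m tan(c m) = 1/β`; for `β = 0`, its
limiting value `π / (2c)`. -/
def robinMu (β c : ℝ) : ℝ :=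
  if β = 0 then π / (2 * c) else sInf {m : ℝ | 0 < m ∧ m * tan (c * m) = 1 / β}

/-- The square of `robinMu`, as a function of `c`. -/
def robinMu₂ (β c : ℝ) : ℝ := robinMu β c ^ 2

/-- GG-concavity of a function `(0, ∞) → (0, ∞)`. -/
def GGConcave (f : ℝ → ℝ) : Prop :=
  (∀ x, 0 < x → 0 < f x) ∧
    ∀ x₀ x₁, 0 < x₀ → 0 < x₁ → √(f x₀ * f x₁) ≤ f (√(x₀ * x₁))

end

/-! The eigenvalue is found by comparison with `φ = cos (m x) cos (m y)`. Put `T t = m tan (m t)`,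
so that `T' = m² + T²` and `-∇φ / φ = (T x, T y)`. For a Robin eigenfunction `U`, the field `U (∇U +
(T x, T y) U)` has divergence `|∇U + (T x, T y) U|² + (2 m² - lam) U²`, and its flux through each
side vanishes by the boundary condition. The divergence theorem then forces `lam ≥ 2 m²`, with no
regularity or completeness theory for eigenfunctions (`two_mul_sq_le_of_plane`); `φ` itself attains
the bound.

GG-concavity of `μ²` comes from GG-convexity of the tangent: `log (tan (exp s))` has derivative `2
eˢ / sin (2 eˢ)`, increasing because `sin t / t` decreases. Monotonicity of `m tan (c m)` transfers
this to the root `μ(c)`. The inequality between squares is the case `x₀ = r h`, `x₁ = h / r`. -/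

/-! ### Lower bound by the divergence theorem -/

theorem mul_mem_Ioo_neg_pi_div_two {m c t : ℝ} (hm : 0 < m) (hmc : m * c < π / 2)
    (ht : t ∈ Icc (-c) c) : m * t ∈ Ioo (-(π / 2)) (π / 2) :=
  ⟨by nlinarith [ht.1], by nlinarith [ht.2]⟩

theorem continuousOn_mul_tan_mul {m c : ℝ} (hm : 0 < m) (hmc : m * c < π / 2) :
    ContinuousOn (fun t => m * tan (m * t)) (Icc (-c) c) := by
  refine continuousOn_const.mul (continuousOn_tan_Ioo.comp (by fun_prop) ?_)
  exact fun t ht => mul_mem_Ioo_neg_pi_div_two hm hmc ht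

theorem hasDerivAt_mul_tan_mul {m t : ℝ} (h : cos (m * t) ≠ 0) :
    HasDerivAt (fun t => m * tan (m * t)) (m ^ 2 + (m * tan (m * t)) ^ 2) t := by
  have h1 := ((hasDerivAt_tan h).comp t ((hasDerivAt_id t).const_mul m)).const_mul m
  refine h1.congr_deriv ?_
  have : 1 / cos (m * t) ^ 2 = 1 + tan (m * t) ^ 2 := by
    rw [tan_eq_sin_div_cos]; field_simp; rw [add_comm]; exact (sin_sq_add_cos_sq _).symm
  simp only [this]
  ring

/-- A Robin solution on a square in the plane, described by a function `U`, its partial derivatives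
`P`, `Q` and their differentials, has eigenvalue at least `2 m ^ 2`, where `m` is such that
`U` times the outward flux of `∇U + (m tan (m x), m tan (m y)) U` vanishes on the sides. -/
theorem two_mul_sq_le_of_plane {c m lam : ℝ} (hc : 0 < c) (hm : 0 < m) (hmc : m * c < π / 2)
    {U P Q : ℝ × ℝ → ℝ} {P' Q' : ℝ × ℝ → ℝ × ℝ →L[ℝ] ℝ}
    (hU : ContinuousOn U (Icc (-c) c ×ˢ Icc (-c) c))
    (hP : ContinuousOn P (Icc (-c) c ×ˢ Icc (-c) c))
    (hQ : ContinuousOn Q (Icc (-c) c ×ˢ Icc (-c) c))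
    (hU' : ∀ p ∈ Ioo (-c) c ×ˢ Ioo (-c) c, HasFDerivAt U
      (P p • ContinuousLinearMap.fst ℝ ℝ ℝ + Q p • ContinuousLinearMap.snd ℝ ℝ ℝ) p)
    (hP' : ∀ p ∈ Ioo (-c) c ×ˢ Ioo (-c) c, HasFDerivAt P (P' p) p)
    (hQ' : ∀ p ∈ Ioo (-c) c ×ˢ Ioo (-c) c, HasFDerivAt Q (Q' p) p)
    (hΔ : ∀ p ∈ Ioo (-c) c ×ˢ Ioo (-c) c, P' p (1, 0) + Q' p (0, 1) + lam * U p = 0)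
    (hne : ∃ p ∈ Ioo (-c) c ×ˢ Ioo (-c) c, U p ≠ 0)
    (hPb : ∀ σ : ℝ, (σ = 1 ∨ σ = -1) → ∀ y ∈ Ioo (-c) c,
      U (σ * c, y) * (σ * P (σ * c, y) + m * tan (m * c) * U (σ * c, y)) = 0)
    (hQb : ∀ σ : ℝ, (σ = 1 ∨ σ = -1) → ∀ x ∈ Ioo (-c) c,
      U (x, σ * c) * (σ * Q (x, σ * c) + m * tan (m * c) * U (x, σ * c)) = 0) :
    2 * m ^ 2 ≤ lam := by
  set S : Set (ℝ × ℝ) := Ioo (-c) c ×ˢ Ioo (-c) c with hS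
  have hSo : IsOpen S := isOpen_Ioo.prod isOpen_Ioo
  have hIcc : Icc ((-c, -c) : ℝ × ℝ) (c, c) = Icc (-c) c ×ˢ Icc (-c) c := (Icc_prod_eq _ _)
  have hSK : S ⊆ Icc (-c) c ×ˢ Icc (-c) c := prod_mono Ioo_subset_Icc_self Ioo_subset_Icc_self
  have hae : (S : Set (ℝ × ℝ)) =ᵐ[MeasureTheory.volume] (Icc (-c) c ×ˢ Icc (-c) c) :=
    MeasureTheory.Measure.set_prod_ae_eq MeasureTheory.Ioo_ae_eq_Icc MeasureTheory.Ioo_ae_eq_Icc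
  set T : ℝ → ℝ := fun t => m * tan (m * t) with hT
  have hTc : ContinuousOn T (Icc (-c) c) := continuousOn_mul_tan_mul hm hmc
  have hT1 : ContinuousOn (fun p : ℝ × ℝ => T p.1) (Icc (-c) c ×ˢ Icc (-c) c) :=
    hTc.comp continuousOn_fst fun p hp => hp.1
  have hT2 : ContinuousOn (fun p : ℝ × ℝ => T p.2) (Icc (-c) c ×ˢ Icc (-c) c) :=
    hTc.comp continuousOn_snd fun p hp => hp.2
  have hTd : ∀ t ∈ Ioo (-c) c, HasDerivAt T (m ^ 2 + T t ^ 2) t := fun t ht =>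
    hasDerivAt_mul_tan_mul
      (cos_pos_of_mem_Ioo (mul_mem_Ioo_neg_pi_div_two hm hmc (Ioo_subset_Icc_self ht))).ne'
  set f : ℝ × ℝ → ℝ := fun p => U p * (P p + T p.1 * U p) with hf
  set g : ℝ × ℝ → ℝ := fun p => U p * (Q p + T p.2 * U p) with hg
  -- The divergence of `(f, g)`, with second derivatives eliminated by the equation; in this form it
  -- is continuous up to the boundary, hence integrable.
  set G : ℝ × ℝ → ℝ := fun p =>
    (P p + T p.1 * U p) ^ 2 + (Q p + T p.2 * U p) ^ 2 + (2 * m ^ 2 - lam) * U p ^ 2 with hG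
  have hGc : ContinuousOn G (Icc (-c) c ×ˢ Icc (-c) c) :=
    (((hP.add (hT1.mul hU)).pow 2).add ((hQ.add (hT2.mul hU)).pow 2)).add
      (continuousOn_const.mul (hU.pow 2))
  have hfd : ∀ p ∈ S, ∃ f' : ℝ × ℝ →L[ℝ] ℝ, HasFDerivAt f f' p ∧
      f' (1, 0) = P p * (P p + T p.1 * U p) +
        U p * (P' p (1, 0) + (m ^ 2 + T p.1 ^ 2) * U p + T p.1 * P p) := by
    intro p hp
    have h1 : HasFDerivAt (fun p : ℝ × ℝ => T p.1) _ p :=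
      (hTd p.1 hp.1).hasFDerivAt.comp p hasFDerivAt_fst
    refine ⟨_, (hU' p hp).mul ((hP' p hp).add (h1.mul (hU' p hp))), ?_⟩
    simp
    ring
  have hgd : ∀ p ∈ S, ∃ g' : ℝ × ℝ →L[ℝ] ℝ, HasFDerivAt g g' p ∧
      g' (0, 1) = Q p * (Q p + T p.2 * U p) +
        U p * (Q' p (0, 1) + (m ^ 2 + T p.2 ^ 2) * U p + T p.2 * Q p) := by
    intro p hp
    have h1 : HasFDerivAt (fun p : ℝ × ℝ => T p.2) _ p :=
      (hTd p.2 hp.2).hasFDerivAt.comp p hasFDerivAt_snd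
    refine ⟨_, (hU' p hp).mul ((hQ' p hp).add (h1.mul (hU' p hp))), ?_⟩
    simp
    ring
  have hdiv : ∀ p ∈ S, fderiv ℝ f p (1, 0) + fderiv ℝ g p (0, 1) = G p := by
    intro p hp
    obtain ⟨f', h1, h2⟩ := hfd p hp
    obtain ⟨g', h3, h4⟩ := hgd p hp
    rw [h1.fderiv, h3.fderiv, h2, h4]
    simp only [hG]
    linear_combination U p * hΔ p hp
  have hGi : MeasureTheory.IntegrableOn G S :=
    (hGc.integrableOn_compact (isCompact_Icc.prod isCompact_Icc)).mono_set hSK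
  have hTneg : T (-c) = -T c := by simp [hT]
  have key := MeasureTheory.integral_divergence_prod_Icc_of_hasFDerivAt_of_le f g
    (fun p => fderiv ℝ f p) (fun p => fderiv ℝ g p) (-c, -c) (c, c)
    (Prod.mk_le_mk.2 ⟨by linarith, by linarith⟩)
    (by rw [hIcc]; exact hU.mul (hP.add (hT1.mul hU)))
    (by rw [hIcc]; exact hU.mul (hQ.add (hT2.mul hU)))
    (fun p hp => (hfd p hp).choose_spec.1.differentiableAt.hasFDerivAt)
    (fun p hp => (hgd p hp).choose_spec.1.differentiableAt.hasFDerivAt)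
    (by
      rw [hIcc]
      exact (hGi.congr_fun (fun p hp => (hdiv p hp).symm) hSo.measurableSet).congr_set_ae hae.symm)
  -- The open side suffices, as no boundary condition holds at the corners.
  have hz : ∀ {k : ℝ → ℝ}, (∀ x ∈ Ioo (-c) c, k x = 0) → ∫ x in (-c)..c, k x = 0 := by
    intro k hk
    rw [intervalIntegral.integral_congr_uIoo (g := fun _ => 0)]
    · simp
    · rwa [uIoo_of_le (by linarith)]
  rw [hIcc, ← MeasureTheory.setIntegral_congr_set hae,
    MeasureTheory.setIntegral_congr_fun hSo.measurableSet hdiv] at key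
  simp only at key
  rw [hz, hz, hz, hz] at key
  rotate_left
  · intro y hy; have := hPb (-1) (Or.inr rfl) y hy
    simp only [neg_mul, one_mul] at this
    simp only [hf, hTneg]; simp only [hT]; linear_combination -this
  · intro y hy; have := hPb 1 (Or.inl rfl) y hy
    simp only [one_mul] at this
    simpa only [hf, hT] using this
  · intro y hy; have := hQb (-1) (Or.inr rfl) y hy
    simp only [neg_mul, one_mul] at this
    simp only [hg, hTneg]; simp only [hT]; linear_combination -this
  · intro y hy; have := hQb 1 (Or.inl rfl) y hy
    simp only [one_mul] at this
    simpa only [hg, hT] using this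
  -- If `lam < 2 m²`, then `G ≥ 0` has integral zero; being continuous, it vanishes throughout `S`,
  -- and so does `U`.
  by_contra! hlt
  have hnn : ∀ p, 0 ≤ G p := fun p => by
    have : 0 ≤ (2 * m ^ 2 - lam) * U p ^ 2 := mul_nonneg (by linarith) (sq_nonneg _)
    simp only [hG]; positivity
  have h0 : G =ᵐ[MeasureTheory.volume.restrict S] 0 :=
    (MeasureTheory.setIntegral_eq_zero_iff_of_nonneg_ae (.of_forall hnn) hGi).1 (by simpa using key)
  have hzero := MeasureTheory.Measure.eqOn_open_of_ae_eq h0 hSo (hGc.mono hSK) continuousOn_const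
  obtain ⟨p, hp, hup⟩ := hne
  have h1 : G p = 0 := hzero hp
  have h2 : 0 < (2 * m ^ 2 - lam) * U p ^ 2 := mul_pos (by linarith) (by positivity)
  simp only [hG] at h1
  nlinarith [sq_nonneg (P p + T p.1 * U p), sq_nonneg (Q p + T p.2 * U p)]

/-! ### GG-convexity of the tangent -/

/-- `sinc` decreases on `(0, π)`. -/
theorem antitoneOn_sin_div : AntitoneOn (fun t => sin t / t) (Ioo 0 π) := by
  intro x hx y hy hxy
  rcases hxy.eq_or_lt with rfl | h
  · exact le_rfl
  -- The chord of sine over `[0, x]` is at least as steep as the one over `[x, y]`.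
  have := strictConcaveOn_sin_Icc.concaveOn.slope_anti_adjacent (x := 0) (y := x) (z := y)
    ⟨le_rfl, pi_pos.le⟩ ⟨hy.1.le, hy.2.le⟩ hx.1 h
  simp only [sin_zero, sub_zero] at this
  have hx0 := hx.1
  have hy0 := hy.1
  have hd : 0 < y - x := by linarith
  simp only
  rw [div_le_div_iff₀ hd hx0] at this
  rw [div_le_div_iff₀ hy0 hx0]
  linarith

theorem convexOn_log_tan_exp : ConvexOn ℝ (Iio (log (π / 2))) fun s => log (tan (exp s)) := by
  have hmem : ∀ s ∈ Iio (log (π / 2)), exp s ∈ Ioo 0 (π / 2) := fun s hs =>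
    ⟨exp_pos s, (lt_log_iff_exp_lt (by positivity)).1 hs⟩
  have hd : ∀ s ∈ Iio (log (π / 2)), HasDerivAt (fun s => log (tan (exp s)))
      ((sin (2 * exp s) / (2 * exp s))⁻¹) s := by
    intro s hs
    obtain ⟨h0, h1⟩ := hmem s hs
    have hc : 0 < cos (exp s) := cos_pos_of_mem_Ioo ⟨by linarith, h1⟩
    have hs' : 0 < sin (exp s) := sin_pos_of_pos_of_lt_pi h0 (by linarith)
    have := ((hasDerivAt_tan hc.ne').comp s (hasDerivAt_exp s)).log
      (tan_pos_of_pos_of_lt_pi_div_two h0 h1).ne'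
    refine this.congr_deriv ?_
    simp only [Function.comp, sin_two_mul, tan_eq_sin_div_cos]
    field_simp
  refine MonotoneOn.convexOn_of_deriv (convex_Iio _)
    (fun s hs => (hd s hs).continuousAt.continuousWithinAt) ?_ ?_
  · rw [interior_Iio]
    exact fun s hs => (hd s hs).differentiableAt.differentiableWithinAt
  · rw [interior_Iio]
    intro s hs t ht hst
    rw [(hd s hs).deriv, (hd t ht).deriv]
    obtain ⟨s0, s1⟩ := hmem s hs
    obtain ⟨t0, t1⟩ := hmem t ht
    refine inv_anti₀ (div_pos (sin_pos_of_pos_of_lt_pi (by linarith) (by linarith))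
      (by linarith)) ?_
    exact antitoneOn_sin_div ⟨by linarith, by linarith⟩ ⟨by linarith, by linarith⟩
      (by linarith [exp_le_exp.2 hst])

/-- The tangent is GG-convex on `(0, π / 2)`. -/
theorem tan_sqrt_mul_le {a b : ℝ} (ha : a ∈ Ioo 0 (π / 2)) (hb : b ∈ Ioo 0 (π / 2)) :
    tan (√(a * b)) ≤ √(tan a * tan b) := by
  obtain ⟨a0, a1⟩ := ha
  obtain ⟨b0, b1⟩ := hb
  have hta := tan_pos_of_pos_of_lt_pi_div_two a0 a1
  have htb := tan_pos_of_pos_of_lt_pi_div_two b0 b1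
  have hab : √(a * b) < π / 2 := by
    rw [sqrt_lt' (by positivity)]; nlinarith
  have hab0 : 0 < √(a * b) := by positivity
  have := convexOn_log_tan_exp.2 (log_lt_log a0 a1) (log_lt_log b0 b1)
    (one_half_pos (α := ℝ)).le one_half_pos.le (add_halves 1)
  have he : (1 / 2 : ℝ) • log a + (1 / 2 : ℝ) • log b = log (√(a * b)) := by
    rw [log_sqrt (by positivity), log_mul a0.ne' b0.ne']; simp only [smul_eq_mul]; ring
  rw [he] at this
  simp only [smul_eq_mul] at this
  rw [exp_log a0, exp_log b0, exp_log hab0] at this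
  rw [← log_le_log_iff (tan_pos_of_pos_of_lt_pi_div_two hab0 hab) (by positivity),
    log_sqrt (by positivity), log_mul hta.ne' htb.ne']
  linarith

/-! ### The root `μ(c)` and its GG-concavity -/

theorem mul_tan_strictMono {c x y : ℝ} (hc : 0 < c) (hx : 0 < x) (hxy : x < y)
    (hy : c * y < π / 2) : x * tan (c * x) < y * tan (c * y) := by
  have hcx : 0 < c * x := by positivity
  have hlt : c * x < c * y := by nlinarith
  have h1 : 0 < tan (c * x) := tan_pos_of_pos_of_lt_pi_div_two hcx (by linarith)
  have h2 : tan (c * x) < tan (c * y) := tan_lt_tan_of_lt_of_lt_pi_div_two (by linarith) hy hlt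
  exact mul_lt_mul'' hxy h2 hx.le h1.le

theorem exists_mul_tan_eq {c k : ℝ} (hc : 0 < c) (hk : 0 < k) :
    ∃ m, 0 < m ∧ c * m < π / 2 ∧ m * tan (c * m) = k := by
  -- With `t = c m` the equation becomes `t tan t = k c`, solved by the intermediate value theorem
  -- on `[0, π / 2)`.
  have hlim : Filter.Tendsto (fun t => t * tan t) (nhdsWithin (π / 2) (Iio (π / 2)))
      Filter.atTop :=
    Filter.Tendsto.pos_mul_atTop (C := π / 2) (by positivity)
      (Filter.tendsto_id.mono_left nhdsWithin_le_nhds) tendsto_tan_pi_div_two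
  have hpos : ∀ᶠ t in nhdsWithin (π / 2) (Iio (π / 2)), t ∈ Ioo 0 (π / 2) :=
    Ioo_mem_nhdsLT (by positivity)
  obtain ⟨t, ht, ht'⟩ := ((hlim.eventually_gt_atTop (k * c)).and hpos).exists
  have hcont : ContinuousOn (fun t => t * tan t) (Icc 0 t) :=
    continuousOn_id.mul (continuousOn_tan_Ioo.mono fun s hs =>
      ⟨by linarith [hs.1, pi_pos], by linarith [hs.2, ht'.2]⟩)
  obtain ⟨s, hs, hs'⟩ := intermediate_value_Icc ht'.1.le hcont
    (show k * c ∈ Icc _ _ from ⟨by simp only [zero_mul]; positivity, ht.le⟩)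
  simp only at hs'
  have hs0 : 0 < s := by
    rcases hs.1.eq_or_lt with h | h
    · rw [← h] at hs'; simp at hs'; rcases hs' with h | h <;> linarith
    · exact h
  have hcs : c * (s / c) = s := by field_simp
  refine ⟨s / c, by positivity, ?_, ?_⟩
  · rw [hcs]; linarith [hs.2, ht'.2]
  · rw [hcs]; field_simp; linarith

theorem robinMu_spec {β c : ℝ} (hβ : 0 < β) (hc : 0 < c) :
    0 < robinMu β c ∧ c * robinMu β c < π / 2 ∧
      robinMu β c * tan (c * robinMu β c) = 1 / β := by
  obtain ⟨m, hm, hcm, he⟩ := exists_mul_tan_eq hc (one_div_pos.2 hβ)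
  have hleast : IsLeast {m : ℝ | 0 < m ∧ m * tan (c * m) = 1 / β} m := by
    refine ⟨⟨hm, he⟩, fun x hx => ?_⟩
    by_contra! hlt
    exact (mul_tan_strictMono hc hx.1 hlt hcm).ne (hx.2.trans he.symm)
  have : robinMu β c = m := by rw [robinMu, if_neg hβ.ne', hleast.csInf_eq]
  rw [this]
  exact ⟨hm, hcm, he⟩

theorem robinMu_zero (c : ℝ) : robinMu 0 c = π / (2 * c) := if_pos rfl

theorem robinMu_pos {β c : ℝ} (hβ : 0 ≤ β) (hc : 0 < c) : 0 < robinMu β c := by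
  rcases hβ.eq_or_lt with rfl | h
  · rw [robinMu_zero]; positivity
  · exact (robinMu_spec h hc).1

/-- For `β = 0` equality holds. Otherwise, a root at `√(x y)` below `√(a b)` would give `1/β < √(a
b) tan √(x a · y b) ≤ √(a tan (x a) · b tan (y b)) = 1/β`. -/
theorem sqrt_robinMu_mul_le {β x y : ℝ} (hβ : 0 ≤ β) (hx : 0 < x) (hy : 0 < y) :
    √(robinMu β x * robinMu β y) ≤ robinMu β (√(x * y)) := by
  rcases hβ.eq_or_lt with rfl | h
  · simp only [robinMu_zero]
    have : π / (2 * x) * (π / (2 * y)) = (π / 2) ^ 2 / (x * y) := by field_simp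
    rw [this, sqrt_div (by positivity), sqrt_sq (by positivity), div_div]
  obtain ⟨a0, a1, a2⟩ := robinMu_spec h hx
  obtain ⟨b0, b1, b2⟩ := robinMu_spec h hy
  have hz : 0 < √(x * y) := by positivity
  obtain ⟨k0, k1, k2⟩ := robinMu_spec h hz
  set a := robinMu β x
  set b := robinMu β y
  set k := robinMu β (√(x * y))
  by_contra! hlt
  have hza : √(x * y) * √(a * b) = √((x * a) * (y * b)) := by
    rw [← sqrt_mul (by positivity)]; congr 1; ring
  have hlt' : √(x * y) * √(a * b) < π / 2 := by
    have := mul_pos hx a0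
    have := mul_pos hy b0
    rw [hza, sqrt_lt' (by positivity)]
    nlinarith
  have h1 := mul_tan_strictMono hz k0 hlt hlt'
  rw [k2, hza] at h1
  have h2 := tan_sqrt_mul_le ⟨mul_pos hx a0, a1⟩ ⟨mul_pos hy b0, b1⟩
  have h3 : √(a * b) * √(tan (x * a) * tan (y * b)) = 1 / β := by
    rw [← sqrt_mul (by positivity),
      show a * b * (tan (x * a) * tan (y * b)) = (a * tan (x * a)) * (b * tan (y * b)) by ring,
      a2, b2, sqrt_mul_self (by positivity)]
  have := mul_le_mul_of_nonneg_left h2 (sqrt_nonneg (a * b))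
  linarith

theorem ggConcave_robinMu₂ {β : ℝ} (hβ : 0 ≤ β) : GGConcave (robinMu₂ β) := by
  refine ⟨fun x hx => pow_pos (robinMu_pos hβ hx) 2, fun x y hx hy => ?_⟩
  have ha := robinMu_pos hβ hx
  have hb := robinMu_pos hβ hy
  simp only [robinMu₂]
  rw [← mul_pow, sqrt_sq (by positivity), ← sq_sqrt (by positivity : 0 ≤ robinMu β x * robinMu β y)]
  exact pow_le_pow_left₀ (sqrt_nonneg _) (sqrt_robinMu_mul_le hβ hx hy) 2

/-! ### Transfer of the bound to the Euclidean plane -/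

/-- The linear identification of `ℝ × ℝ` with the Euclidean plane. -/
noncomputable def planeMap : ℝ × ℝ →L[ℝ] EuclideanSpace ℝ (Fin 2) :=
  (ContinuousLinearMap.fst ℝ ℝ ℝ).smulRight (EuclideanSpace.single 0 1) +
    (ContinuousLinearMap.snd ℝ ℝ ℝ).smulRight (EuclideanSpace.single 1 1)

theorem planeMap_apply (p : ℝ × ℝ) : planeMap p =
    p.1 • EuclideanSpace.single 0 (1 : ℝ) + p.2 • EuclideanSpace.single 1 (1 : ℝ) := rfl

@[simp] theorem planeMap_zero (p : ℝ × ℝ) : planeMap p 0 = p.1 := by simp [planeMap_apply]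

@[simp] theorem planeMap_one (p : ℝ × ℝ) : planeMap p 1 = p.2 := by simp [planeMap_apply]

theorem planeMap_one_zero : planeMap (1, 0) = EuclideanSpace.single 0 (1 : ℝ) := by
  simp [planeMap_apply]

theorem planeMap_zero_one : planeMap (0, 1) = EuclideanSpace.single 1 (1 : ℝ) := by
  simp [planeMap_apply]

theorem mem_box_square {c : ℝ} {x : EuclideanSpace ℝ (Fin 2)} :
    x ∈ box ![c, c] ↔ x 0 ∈ Ioo (-c) c ∧ x 1 ∈ Ioo (-c) c := by
  simp [box, Fin.forall_fin_two]

theorem mem_closedBox_square {c : ℝ} {x : EuclideanSpace ℝ (Fin 2)} :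
    x ∈ closedBox ![c, c] ↔ x 0 ∈ Icc (-c) c ∧ x 1 ∈ Icc (-c) c := by
  simp [closedBox, Fin.forall_fin_two]

theorem isOpen_box {N : ℕ} (a : Fin N → ℝ) : IsOpen (box a) := by
  simp only [box, ofPred_forall]
  exact isOpen_iInter_of_finite fun j => isOpen_Ioo.preimage (by fun_prop)

theorem box_subset_closedBox {N : ℕ} (a : Fin N → ℝ) : box a ⊆ closedBox a :=
  fun _ hx j => Ioo_subset_Icc_self (hx j)

theorem convex_closedBox {N : ℕ} (a : Fin N → ℝ) : Convex ℝ (closedBox a) := by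
  simp only [closedBox, ofPred_forall]
  exact convex_iInter fun j =>
    (convex_Icc (-a j) (a j)).linear_preimage (EuclideanSpace.proj (𝕜 := ℝ) j).toLinearMap

theorem uniqueDiffOn_closedBox {N : ℕ} {a : Fin N → ℝ} (ha : ∀ j, 0 < a j) :
    UniqueDiffOn ℝ (closedBox a) :=
  uniqueDiffOn_convex (convex_closedBox a)
    ⟨0, interior_maximal (box_subset_closedBox a) (isOpen_box a) fun j => by simp [ha j]⟩

theorem laplacian_plane (u : EuclideanSpace ℝ (Fin 2) → ℝ) (x : EuclideanSpace ℝ (Fin 2)) :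
    Laplacian.laplacian u x =
      fderiv ℝ (fderiv ℝ u) x (EuclideanSpace.single 0 1) (EuclideanSpace.single 0 1) +
      fderiv ℝ (fderiv ℝ u) x (EuclideanSpace.single 1 1) (EuclideanSpace.single 1 1) := by
  rw [InnerProductSpace.laplacian_eq_iteratedFDeriv_orthonormalBasis u
    (EuclideanSpace.basisFun (Fin 2) ℝ)]
  simp [iteratedFDeriv_two_apply]

/-- Every Robin eigenvalue of a square is at least `2 m ^ 2` if `m` solves the one-dimensional
Robin equation; for the Dirichlet condition any `m` below `π / (2 c)` will do. -/
theorem two_mul_sq_le_of_isRobinEigenfunction {β c m lam : ℝ} (hc : 0 < c) (hm : 0 < m)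
    (hmc : m * c < π / 2) (hβm : β = 0 ∨ β * (m * tan (m * c)) = 1)
    {u : EuclideanSpace ℝ (Fin 2) → ℝ} (hu : IsRobinEigenfunction β ![c, c] lam u) :
    2 * m ^ 2 ≤ lam := by
  have hK : UniqueDiffOn ℝ (closedBox ![c, c]) :=
    uniqueDiffOn_closedBox (Fin.forall_fin_two.2 ⟨hc, hc⟩)
  have hbox : ∀ p ∈ Ioo (-c) c ×ˢ Ioo (-c) c, planeMap p ∈ box ![c, c] := fun p hp =>
    mem_box_square.2 (by simpa using hp)
  have hmaps : MapsTo planeMap (Icc (-c) c ×ˢ Icc (-c) c) (closedBox ![c, c]) := fun p hp =>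
    mem_closedBox_square.2 (by simpa only [planeMap_zero, planeMap_one] using mem_prod.1 hp)
  have hnhds : ∀ x ∈ box ![c, c], closedBox ![c, c] ∈ nhds x := fun x hx =>
    Filter.mem_of_superset ((isOpen_box _).mem_nhds hx) (box_subset_closedBox _)
  have hDc : ContinuousOn (fun p => fderivWithin ℝ u (closedBox ![c, c]) (planeMap p))
      (Icc (-c) c ×ˢ Icc (-c) c) :=
    (hu.contDiffOn_closedBox.continuousOn_fderivWithin hK le_rfl).comp
      planeMap.continuous.continuousOn hmaps
  have hu2 : ∀ x ∈ box ![c, c], ContDiffAt ℝ 2 u x := fun x hx =>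
    hu.contDiffOn_box.contDiffAt ((isOpen_box _).mem_nhds hx)
  have hD' : ∀ p ∈ Ioo (-c) c ×ˢ Ioo (-c) c, ∀ v,
      HasFDerivAt (fun p => fderivWithin ℝ u (closedBox ![c, c]) (planeMap p) v)
        (((fderiv ℝ (fderiv ℝ u) (planeMap p)).flip v).comp planeMap) p := by
    intro p hp v
    have h1 : DifferentiableAt ℝ (fderiv ℝ u) (planeMap p) :=
      ((hu2 _ (hbox p hp)).fderiv_right (m := 1) (by norm_num)).differentiableAt (by norm_num)
    have h2 : HasFDerivAt (fun p => fderiv ℝ u (planeMap p) v)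
        (((fderiv ℝ (fderiv ℝ u) (planeMap p)).flip v).comp planeMap) p := by
      have h3 := (h1.hasFDerivAt.comp p planeMap.hasFDerivAt).clm_apply (hasFDerivAt_const v p)
      refine h3.congr_fderiv ?_
      ext <;> simp
    refine h2.congr_of_eventuallyEq ?_
    filter_upwards [(isOpen_Ioo.prod isOpen_Ioo).mem_nhds hp] with q hq
    rw [fderivWithin_of_mem_nhds (hnhds _ (hbox q hq))]
  -- Dirichlet kills the factor `b`; otherwise `β (m tan (m c)) = 1` turns the Robin condition into
  -- the vanishing of the other factor.
  have hflux : ∀ {a b : ℝ}, β * a + b = 0 → b * (a + m * tan (m * c) * b) = 0 := by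
    intro a b hab
    rcases hβm with rfl | h
    · rw [zero_mul, zero_add] at hab; simp [hab]
    · linear_combination b * (m * tan (m * c)) * hab - a * b * h
  have hsingle : ∀ (j : Fin 2) (σ : ℝ), EuclideanSpace.single j σ =
      σ • (EuclideanSpace.single j 1 : EuclideanSpace ℝ (Fin 2)) := fun j σ => by
    ext i; simp
  -- Derivatives within the closed box are continuous up to the boundary and agree with the ordinary
  -- ones inside.
  refine two_mul_sq_le_of_plane (U := fun p => u (planeMap p))
    (P := fun p => fderivWithin ℝ u (closedBox ![c, c]) (planeMap p) (EuclideanSpace.single 0 1))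
    (Q := fun p => fderivWithin ℝ u (closedBox ![c, c]) (planeMap p) (EuclideanSpace.single 1 1))
    hc hm hmc (hu.contDiffOn_closedBox.continuousOn.comp planeMap.continuous.continuousOn hmaps)
    (hDc.clm_apply continuousOn_const) (hDc.clm_apply continuousOn_const) ?_
    (fun p hp => hD' p hp _) (fun p hp => hD' p hp _) ?_ ?_ ?_ ?_
  · intro p hp
    have h1 : HasFDerivAt u _ (planeMap p) :=
      ((hu2 _ (hbox p hp)).differentiableAt (by norm_num)).hasFDerivAt
    refine (h1.comp p planeMap.hasFDerivAt).congr_fderiv ?_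
    simp only [fderivWithin_of_mem_nhds (hnhds _ (hbox p hp))]
    ext <;> simp [planeMap_one_zero, planeMap_zero_one]
  · intro p hp
    have := hu.helmholtz _ (hbox p hp)
    rw [laplacian_plane] at this
    simpa [planeMap_one_zero, planeMap_zero_one] using this
  · obtain ⟨x, hx, hux⟩ := hu.ne_zero
    have hx' : planeMap (x 0, x 1) = x := by ext i; fin_cases i <;> simp
    exact ⟨(x 0, x 1), mem_box_square.1 hx, by rwa [hx']⟩
  · intro σ hσ y hy
    have := hu.robin 0 σ hσ (planeMap (σ * c, y)) ⟨by simp, by simpa [Fin.forall_fin_two] using hy⟩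
    rw [hsingle, map_smul, smul_eq_mul] at this
    exact hflux this
  · intro σ hσ y hy
    have := hu.robin 1 σ hσ (planeMap (y, σ * c)) ⟨by simp, by simpa [Fin.forall_fin_two] using hy⟩
    rw [hsingle, map_smul, smul_eq_mul] at this
    exact hflux this

/-! ### The cosine eigenfunction and the fundamental eigenvalue -/

theorem hasFDerivAt_comp_coord {f f' : ℝ → ℝ} (hf : ∀ t, HasDerivAt f (f' t) t) (i : Fin 2)
    (x : EuclideanSpace ℝ (Fin 2)) :
    HasFDerivAt (fun x : EuclideanSpace ℝ (Fin 2) => f (x i))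
      (f' (x i) • EuclideanSpace.proj (𝕜 := ℝ) i) x :=
  (hf (x i)).comp_hasFDerivAt x (EuclideanSpace.proj (𝕜 := ℝ) i).hasFDerivAt

theorem hasDerivAt_cos_mul (m t : ℝ) :
    HasDerivAt (fun t => cos (m * t)) (-(m * sin (m * t))) t :=
  (((hasDerivAt_id t).const_mul m).cos).congr_deriv (by simp; ring)

theorem hasDerivAt_neg_mul_sin_mul (m t : ℝ) :
    HasDerivAt (fun t => -(m * sin (m * t))) (-(m ^ 2 * cos (m * t))) t :=
  ((((hasDerivAt_id t).const_mul m).sin).const_mul m).neg.congr_deriv (by simp; ring)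

/-- The hypothesis is the one-dimensional Robin condition cleared of its denominator, so that `cos
(m c) = 0` covers the Dirichlet case. -/
theorem isRobinEigenfunction_cos_mul_cos {β c m : ℝ} (hc : 0 < c)
    (hm : β * (m * sin (m * c)) = cos (m * c)) :
    IsRobinEigenfunction β ![c, c] (2 * m ^ 2) fun x => cos (m * x 0) * cos (m * x 1) := by
  have hC : ContDiff ℝ 2 fun x : EuclideanSpace ℝ (Fin 2) => cos (m * x 0) * cos (m * x 1) := by
    fun_prop
  have hd : ∀ x : EuclideanSpace ℝ (Fin 2),
      HasFDerivAt (fun x : EuclideanSpace ℝ (Fin 2) => cos (m * x 0) * cos (m * x 1))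
        ((cos (m * x 0) * -(m * sin (m * x 1))) • EuclideanSpace.proj (𝕜 := ℝ) 1 +
          (cos (m * x 1) * -(m * sin (m * x 0))) • EuclideanSpace.proj (𝕜 := ℝ) 0) x := by
    intro x
    have := (hasFDerivAt_comp_coord (hasDerivAt_cos_mul m) 0 x).mul
      (hasFDerivAt_comp_coord (hasDerivAt_cos_mul m) 1 x)
    simp only [smul_smul] at this
    exact this
  refine ⟨hC.contDiffOn, (hC.of_le (by norm_num)).contDiffOn, ⟨0, ?_, by simp⟩, ?_, ?_⟩
  · simp [mem_box_square, hc]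
  · intro x _
    have hfd := funext fun x => (hd x).fderiv
    have h2 := ((((hasFDerivAt_comp_coord (hasDerivAt_cos_mul m) 0 x).mul
      (hasFDerivAt_comp_coord (hasDerivAt_neg_mul_sin_mul m) 1 x)).smul_const
        (EuclideanSpace.proj 1 : EuclideanSpace ℝ (Fin 2) →L[ℝ] ℝ))).add
      (((hasFDerivAt_comp_coord (hasDerivAt_cos_mul m) 1 x).mul
      (hasFDerivAt_comp_coord (hasDerivAt_neg_mul_sin_mul m) 0 x)).smul_const
        (EuclideanSpace.proj 0 : EuclideanSpace ℝ (Fin 2) →L[ℝ] ℝ))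
    rw [laplacian_plane, hfd]
    erw [h2.fderiv]
    simp
    ring
  · intro j σ hσ x hx
    have hxK : x ∈ closedBox ![c, c] := by
      intro i
      by_cases hij : i = j
      · rw [hij, hx.1]
        have : 0 < (![c, c] : Fin 2 → ℝ) j := by fin_cases j <;> simpa
        rcases hσ with rfl | rfl <;> constructor <;> linarith
      · exact Ioo_subset_Icc_self (hx.2 i hij)
    rw [((hd x).hasFDerivWithinAt).fderivWithin
      (uniqueDiffOn_closedBox (Fin.forall_fin_two.2 ⟨hc, hc⟩) x hxK)]
    have hx1 := hx.1
    fin_cases j <;> simp at hx1 ⊢ <;> rw [hx1] <;> rcases hσ with rfl | rfl <;> simp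
    · linear_combination -cos (m * x 1) * hm
    · linear_combination -cos (m * x 1) * hm
    · linear_combination -cos (m * x 0) * hm
    · linear_combination -cos (m * x 0) * hm

theorem isLeast_robinEigenvalues_square {β c : ℝ} (hβ : 0 ≤ β) (hc : 0 < c) :
    IsLeast (robinEigenvalues β ![c, c]) (2 * robinMu₂ β c) := by
  rcases hβ.eq_or_lt with rfl | h
  · rw [robinMu₂, robinMu_zero]
    have hcm : π / (2 * c) * c = π / 2 := by field_simp
    refine ⟨⟨_, isRobinEigenfunction_cos_mul_cos hc (by rw [hcm]; simp)⟩, ?_⟩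
    rintro lam ⟨u, hu⟩
    -- At `m = π / (2 c)` the field `T` blows up on the sides, so the bound is proved for smaller
    -- `m` and passed to the limit.
    have hlim : Filter.Tendsto (fun m : ℝ => 2 * m ^ 2)
        (nhdsWithin (π / (2 * c)) (Iio (π / (2 * c)))) (nhds (2 * (π / (2 * c)) ^ 2)) :=
      (Continuous.tendsto (by fun_prop) _).mono_left nhdsWithin_le_nhds
    refine le_of_tendsto hlim ?_
    filter_upwards [Ioo_mem_nhdsLT (show (0 : ℝ) < π / (2 * c) by positivity)] with m hm
    exact two_mul_sq_le_of_isRobinEigenfunction hc hm.1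
      (by rw [← hcm]; exact mul_lt_mul_of_pos_right hm.2 hc) (Or.inl rfl) hu
  · obtain ⟨h0, h1, h2⟩ := robinMu_spec h hc
    rw [robinMu₂]
    set m := robinMu β c
    rw [mul_comm] at h1
    rw [mul_comm c] at h2
    have hβm : β * (m * tan (m * c)) = 1 := by rw [h2]; field_simp
    have hcos : 0 < cos (m * c) := cos_pos_of_mem_Ioo ⟨by have := mul_pos h0 hc; linarith [pi_pos], h1⟩
    refine ⟨⟨_, isRobinEigenfunction_cos_mul_cos hc ?_⟩, ?_⟩
    · rw [← tan_mul_cos hcos.ne']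
      linear_combination cos (m * c) * hβm
    · rintro lam ⟨u, hu⟩
      exact two_mul_sq_le_of_isRobinEigenfunction hc h0 h1 (Or.inr hβm) hu

theorem mainTheorem10 (β : ℝ) (hβ : 0 ≤ β) :
    (∀ c : ℝ, 0 < c →
      IsLeast (robinEigenvalues β ![c, c]) (robinLambda₁ β ![c, c]) ∧
        robinLambda₁ β ![c, c] = 2 * robinMu₂ β c) ∧
    (∀ h r : ℝ, 0 < h → 0 < r → r ≤ 1 →
      √(robinLambda₁ β ![r * h, r * h] * robinLambda₁ β ![h / r, h / r])
        ≤ robinLambda₁ β ![h, h]) ∧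
    GGConcave (robinMu₂ β) := by
  have hlam : ∀ c : ℝ, 0 < c → robinLambda₁ β ![c, c] = 2 * robinMu₂ β c := fun c hc =>
    (isLeast_robinEigenvalues_square hβ hc).csInf_eq
  refine ⟨fun c hc => ⟨?_, hlam c hc⟩, fun h r hh hr _ => ?_, ggConcave_robinMu₂ hβ⟩
  · rw [hlam c hc]
    exact isLeast_robinEigenvalues_square hβ hc
  · have := (ggConcave_robinMu₂ hβ).2 (r * h) (h / r) (by positivity) (by positivity)
    rw [hlam _ (by positivity), hlam _ (by positivity), hlam _ hh, mul_mul_mul_comm,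
      sqrt_mul (by norm_num), sqrt_mul_self (by norm_num)]
    rw [show r * h * (h / r) = h * h by field_simp, sqrt_mul_self hh.le] at this
    linarith
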